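/- Let $D$ be the semi-infinite Jacobi matrix with rows and columns indexed by $\mathbb Z_+=\{0,1,2,\dots\}$, with zero diagonal and with entries $D(n-1,n)=D(n,n-1)=\sqrt n$ for $n\ge 1$ (all other entries are $0$). Regard $D$ as an operator in the complex Hilbert space $\ell^2(\mathbb Z_+)$ whose domain is the algebraic span of the standard basis vectors $\delta_x$, $x\in\mathbb Z_+$. Then $D$ is essentially self-adjoint. Its closure $\overline D$ has simple, purely absolutely continuous, Lebesgue spectrum. That is, $\overline D=\int t\,dP(t)$ for a projection-valued measure $P$ on the Borel sets of $\mathbb R$ (the spectral measure of $\overline D$), and: * (simplicity) there is a vector $v$ such that the vectors $P_Bv$, with $B\subseteq\mathbb R$ Borel, span a dense subspace of $\ell^2(\mathbb Z_+)$; * (absolute continuity) for every $v\in\ell^2(\mathbb Z_+)$, the measure $B\mapsto (P_Bv,v)$ is absolutely continuous with respect to Lebesgue measure; * (Lebesgue type) for every Borel set $B\subseteq\mathbb R$, $P_B=0$ if and only if $B$ has Lebesgue measure $0$. For every Borel set $B\subseteq\mathbb R$, the spectral projection $P_B$ is given by the kernel $$ P_B(x,y)=(P_B\delta_y,\delta_x)=(2\pi\,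 x!\,y!\,2^{x+y})^{-1/2}\int_B e^{-t^2/2}H_x(t/\sqrt2)\,H_y(t/\sqrt2)\,dt,\qquad x,y\in\mathbb Z_+, $$ where $H_n$ is the Hermite polynomial of degree $n$ in the standard (physicists') normalization: $H_0(t)=1$, $H_1(t)=2t$, $H_{n+1}(t)=2tH_n(t)-2nH_{n-1}(t)$ for $n\ge1$. -/

import Mathlib

open MeasureTheory
open scoped InnerProductSpace

noncomputable section

/-! ### Spectral theory of unbounded operators -/

section Spectral

variable {H : Type*} [NormedAddCommGroup H] [InnerProductSpace ℂ H] [CompleteSpace H]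

/-- A partially defined operator is essentially self-adjoint if it is closable and its closure
is self-adjoint. -/
def IsEssentiallySelfAdjoint (T : H →ₗ.[ℂ] H) : Prop :=
  T.IsClosable ∧ IsSelfAdjoint T.closure

variable (H) in
/-- A projection-valued measure on the Borel sets of `ℝ` with values in the orthogonal projections
of `H`. The values of `proj` on non-Borel sets are irrelevant. -/
structure ProjectionValuedMeasure where
  /-- The projection attached to a set. -/
  proj : Set ℝ → H →L[ℂ] H
  isStarProjection : ∀ B, MeasurableSet B → IsStarProjection (proj B)
  proj_empty : proj ∅ = 0
  proj_univ : proj Set.univ = 1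
  proj_inter : ∀ B C, MeasurableSet B → MeasurableSet C → proj (B ∩ C) = proj B * proj C
  hasSum_iUnion : ∀ f : ℕ → Set ℝ, (∀ i, MeasurableSet (f i)) → Pairwise (Function.onFun Disjoint f) →
    ∀ v : H, HasSum (fun i => proj (f i) v) (proj (⋃ i, f i) v)

namespace ProjectionValuedMeasure

variable (P : ProjectionValuedMeasure H)

theorem inner_proj_nonneg {B : Set ℝ} (hB : MeasurableSet B) (v : H) :
    0 ≤ (⟪v, P.proj B v⟫_ℂ).re := by
  have h := P.isStarProjection B hB
  have h1 : P.proj B v = P.proj B (P.proj B v) := by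
    conv_lhs => rw [← h.isIdempotentElem.eq]
    rfl
  have h2 : ⟪v, P.proj B (P.proj B v)⟫_ℂ = ⟪P.proj B v, P.proj B v⟫_ℂ := by
    rw [← ContinuousLinearMap.adjoint_inner_left, h.isSelfAdjoint.adjoint_eq]
  rw [h1, h2]
  exact inner_self_nonneg (𝕜 := ℂ)

/-- The scalar spectral measure `B ↦ (P_B v, v)` of a vector `v`. -/
def scalarMeasure (v : H) : Measure ℝ :=
  Measure.ofMeasurable (fun B _ => ENNReal.ofReal (⟪v, P.proj B v⟫_ℂ).re)
    (by simp [P.proj_empty])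
    (by
      intro f hf hd
      have h1 := (P.hasSum_iUnion f hf hd v).mapL (innerSL ℂ v)
      have h2 := Complex.hasSum_re h1
      simp only [innerSL_apply_apply] at h2
      rw [← h2.tsum_eq]
      exact ENNReal.ofReal_tsum_of_nonneg (fun i => P.inner_proj_nonneg (hf i) v) h2.summable)

/-- `P` is the spectral measure of `A`, i.e. `A = ∫ t dP(t)`: the domain of `A` is
`{v | ∫ t² d(P v, v) < ∞}`, and `(A v, v) = ∫ t d(P v, v)` for all `v` in it (by polarization
this determines `A`). -/
def IsSpectralMeasureOf (A : H →ₗ.[ℂ] H) : Prop :=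
  (∀ v : H, v ∈ A.domain ↔ Integrable (fun t : ℝ => t ^ 2) (P.scalarMeasure v)) ∧
    ∀ v : A.domain, ⟪(v : H), A v⟫_ℂ = ((∫ t : ℝ, t ∂(P.scalarMeasure (v : H)) : ℝ) : ℂ)

/-- Simple spectrum: there is a cyclic vector, that is, a vector `v` such that the vectors
`P_B v`, with `B` Borel, span a dense subspace. -/
def HasSimpleSpectrum : Prop :=
  ∃ v : H, (Submodule.span ℂ {w : H | ∃ B : Set ℝ, MeasurableSet B ∧ w = P.proj B v}).topologicalClosure = ⊤

/-- Purely absolutely continuous spectrum: all scalar spectral measures are absolutely continuous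
with respect to Lebesgue measure. -/
def IsPurelyAbsolutelyContinuous : Prop :=
  ∀ v : H, P.scalarMeasure v ≪ volume

/-- The spectral type is that of Lebesgue measure on the whole real line: the spectral null sets
are exactly the Lebesgue null sets. -/
def HasLebesgueSpectralType : Prop :=
  ∀ B : Set ℝ, MeasurableSet B → (P.proj B = 0 ↔ volume B = 0)

end ProjectionValuedMeasure

end Spectral

/-! ### The Hermite Jacobi operator -/

/-- The complex Hilbert space of square-summable sequences indexed by the nonnegative integers. -/
abbrev EllTwo : Type := lp (fun _ : ℕ => ℂ) 2

/-- The standard basis vector supported at `x`. -/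
def deltaVec (x : ℕ) : EllTwo := lp.single 2 x (1 : ℂ)

/-- The semi-infinite Jacobi matrix with zero diagonal and off-diagonal entries `√1, √2, √3, …`. -/
def hermiteMatrix (x y : ℕ) : ℝ :=
  if y = x + 1 then √(y : ℝ) else if x = y + 1 then √(x : ℝ) else 0

/-- The algebraic span of the standard basis vectors. -/
def finiteVectors : Submodule ℂ EllTwo := Submodule.span ℂ (Set.range deltaVec)

theorem finite_support_of_mem {v : EllTwo} (hv : v ∈ finiteVectors) :
    (Function.support (fun x => v x)).Finite := by
  induction hv using Submodule.span_induction with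
  | mem v hv =>
    obtain ⟨x, rfl⟩ := hv
    refine (Set.finite_singleton x).subset fun y hy => ?_
    by_contra hne
    exact hy (by simp [deltaVec, lp.single_apply, show y ≠ x from hne])
  | zero => simp
  | add v w _ _ hv hw =>
    exact (hv.union hw).subset (Function.support_add (fun x => v x) (fun x => w x))
  | smul a v _ hv =>
    exact hv.subset (Function.support_const_smul_subset a (fun x => v x))

theorem finite_support_term {v : EllTwo} (hv : v ∈ finiteVectors) (x : ℕ) :
    (Function.support (fun y => (hermiteMatrix x y : ℂ) * v y)).Finite :=
  (finite_support_of_mem hv).subset (Function.support_mul_subset_right _ _)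

theorem memlp_hermite {v : EllTwo} (hv : v ∈ finiteVectors) :
    Memℓp (fun x : ℕ => ∑ᶠ y : ℕ, (hermiteMatrix x y : ℂ) * v y) 2 := by
  refine Memℓp.of_exponent_ge (q := 0) (memℓp_zero ?_) zero_le
  have h := finite_support_of_mem hv
  refine ((h.image (fun y => y + 1)).union (h.image (fun y => y - 1))).subset fun x hx => ?_
  obtain ⟨y, hy⟩ : ∃ y : ℕ, (hermiteMatrix x y : ℂ) * v y ≠ 0 := by
    by_contra! h0
    exact hx (by simp [h0])
  have hy2 : v y ≠ 0 := right_ne_zero_of_mul hy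
  have hy1 : hermiteMatrix x y ≠ 0 := by exact_mod_cast left_ne_zero_of_mul hy
  unfold hermiteMatrix at hy1
  split_ifs at hy1 with h1 h2
  · exact Or.inr ⟨y, hy2, by simp [h1]⟩
  · exact Or.inl ⟨y, hy2, h2.symm⟩
  · exact absurd rfl hy1

/-- The operator of the Hermite Jacobi matrix in `ℓ²`, acting on the algebraic span of the
standard basis by matrix multiplication. -/
def hermiteOperator : EllTwo →ₗ.[ℂ] EllTwo where
  domain := finiteVectors
  toFun :=
    { toFun := fun v =>
        ⟨fun x : ℕ => ∑ᶠ y : ℕ, (hermiteMatrix x y : ℂ) * (v : EllTwo) y, memlp_hermite v.2⟩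
      map_add' := by
        intro v w
        ext x
        simp only [lp.coeFn_add, Submodule.coe_add, Pi.add_apply, mul_add]
        exact finsum_add_distrib (finite_support_term v.2 x) (finite_support_term w.2 x)
      map_smul' := by
        intro a v
        ext x
        simp only [lp.coeFn_smul, Submodule.coe_smul, Pi.smul_apply, RingHom.id_apply, smul_eq_mul,
          mul_left_comm _ a]
        exact (mul_finsum _ a).symm }

/-- The (physicists') Hermite polynomials: `H₀ = 1`, `H₁ = 2t`,
`Hₙ₊₂ = 2t Hₙ₊₁ - 2(n+1) Hₙ`. -/
def hermiteH : ℕ → Polynomial ℝ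
  | 0 => 1
  | 1 => Polynomial.C 2 * Polynomial.X
  | n + 2 => Polynomial.C 2 * Polynomial.X * hermiteH (n + 1)
      - Polynomial.C (2 * ((n : ℝ) + 1)) * hermiteH n

/-- The kernel
`(2π x! y! 2^(x+y))^(-1/2) ∫_B exp(-t²/2) H_x(t/√2) H_y(t/√2) dt`. -/
def hermiteKernel (B : Set ℝ) (x y : ℕ) : ℝ :=
  (2 * Real.pi * (x.factorial : ℝ) * (y.factorial : ℝ) * 2 ^ (x + y)) ^ (-(1 / 2) : ℝ) *
    ∫ t in B, Real.exp (-t ^ 2 / 2) * (hermiteH x).eval (t / √2) * (hermiteH y).eval (t / √2)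

end

/-!
On the Hilbert space `L²(γ)` of the standard Gaussian measure `γ` the normalized Hermite polynomials
`Hₙ(t/√2) / √(2ⁿ n!)` form an orthonormal basis (`hermiteBasis`), and multiplication by the variable
acts on this basis by the Jacobi matrix (`X_mul_hermitePoly`). The unitary `gaussianEquiv` therefore
turns the operator into multiplication by `t` on polynomials, and everything is read off there.

*Completeness and essential self-adjointness* both follow from the determinacy of moments
(`ae_eq_zero_of_moments`): a function `k` with `k exp (c|t|)` integrable for all `c` and with
vanishing moments is zero. Applied to `t f - g`, where `g` corresponds to the adjoint at the vector of
`f`, it shows that the adjoint is multiplication by `t` on its maximal domain. Hence the adjoint is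
symmetric, and a densely defined symmetric operator with symmetric adjoint is essentially
self-adjoint with closure equal to its adjoint (`LinearPMap.closure_eq_adjoint`). Multiplication by
indicator functions is thus a spectral measure of the closure, `hermitePVM`.

*Uniqueness.* The spectral projections of an arbitrary spectral measure `P` commute with the operator
(`ProjectionValuedMeasure.IsSpectralMeasureOf.apply_proj`). So `P_B` acts on polynomials as
multiplication by the image of `1`, a real function, and commutes with multiplication by indicator
functions. Two commuting spectral measures of the same operator coincide
(`ProjectionValuedMeasure.IsSpectralMeasureOf.unique_of_commute`), because a vector in the range of
the projections of `(-∞, a]` for one and of `(a, ∞)` for the other would have a quadratic form that is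
both `≤ a` and `> a`. Hence `P` is `hermitePVM`, whose properties are explicit: the constant function
`1` is cyclic, and `γ` has the null sets of Lebesgue measure.
-/

/-! ### Projection-valued measures -/

section Uniqueness

variable {H : Type*} [NormedAddCommGroup H] [InnerProductSpace ℂ H]

/-- Polarization: a linear map on a dense subspace is determined by its quadratic form. -/
theorem LinearMap.eq_zero_of_inner_self_eq_zero {D : Submodule ℂ H} (hD : Dense (D : Set H))
    (S : D →ₗ[ℂ] H) (hS : ∀ u : D, ⟪(u : H), S u⟫_ℂ = 0) : S = 0 := by
  ext u
  refine hD.eq_zero_of_inner_right ℂ fun w hw => ?_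
  lift w to D using hw
  have h1 := hS (u + w)
  have h2 := hS (u + Complex.I • w)
  simp only [map_add, map_smul, Submodule.coe_add, Submodule.coe_smul, inner_add_left,
    inner_add_right, inner_smul_left, inner_smul_right, hS, Complex.conj_I] at h1 h2
  linear_combination (1 / 2 : ℂ) * h1 + (1 / 2 * Complex.I) * h2 +
    (1 / 2 * ⟪(w : H), S u⟫_ℂ - 1 / 2 * ⟪(u : H), S w⟫_ℂ) * Complex.I_sq

namespace ProjectionValuedMeasure

variable [CompleteSpace H] (P Q : ProjectionValuedMeasure H) {B C : Set ℝ} {A : H →ₗ.[ℂ] H}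

theorem proj_proj (hB : MeasurableSet B) (hC : MeasurableSet C) (v : H) :
    P.proj B (P.proj C v) = P.proj (B ∩ C) v := by
  rw [P.proj_inter B C hB hC]; rfl

theorem proj_proj_self (hB : MeasurableSet B) (v : H) : P.proj B (P.proj B v) = P.proj B v := by
  rw [P.proj_proj hB hB, Set.inter_self]

theorem inner_proj_left (hB : MeasurableSet B) (v w : H) :
    ⟪P.proj B v, w⟫_ℂ = ⟪v, P.proj B w⟫_ℂ := by
  rw [← ContinuousLinearMap.adjoint_inner_left, (P.isStarProjection B hB).isSelfAdjoint.adjoint_eq]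

theorem inner_self_proj (hB : MeasurableSet B) (v : H) :
    ⟪v, P.proj B v⟫_ℂ = ((‖P.proj B v‖ ^ 2 : ℝ) : ℂ) := by
  conv_lhs => rw [← P.proj_proj_self hB, ← P.inner_proj_left hB, inner_self_eq_norm_sq_to_K]
  simp

theorem scalarMeasure_apply (v : H) (hB : MeasurableSet B) :
    P.scalarMeasure v B = ENNReal.ofReal (‖P.proj B v‖ ^ 2) := by
  rw [scalarMeasure, Measure.ofMeasurable_apply _ hB, P.inner_self_proj hB, Complex.ofReal_re]

instance (v : H) : IsFiniteMeasure (P.scalarMeasure v) :=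
  ⟨by rw [P.scalarMeasure_apply v .univ]; exact ENNReal.ofReal_lt_top⟩

theorem scalarMeasure_real_univ (v : H) : (P.scalarMeasure v).real Set.univ = ‖v‖ ^ 2 := by
  rw [measureReal_def, P.scalarMeasure_apply v .univ, P.proj_univ,
    ENNReal.toReal_ofReal (by positivity)]
  rfl

theorem scalarMeasure_proj (hB : MeasurableSet B) (v : H) :
    P.scalarMeasure (P.proj B v) = (P.scalarMeasure v).restrict B := by
  ext C hC
  rw [Measure.restrict_apply hC, P.scalarMeasure_apply _ hC, P.scalarMeasure_apply _ (hC.inter hB),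
    P.proj_proj hC hB]

theorem proj_add_proj_compl (hB : MeasurableSet B) (v : H) :
    P.proj B v + P.proj Bᶜ v = v := by
  -- The defect `u` is annihilated by both projections, so its scalar measure vanishes.
  set u := v - (P.proj B v + P.proj Bᶜ v) with hu
  have h1 : P.proj B u = 0 := by
    simp [hu, P.proj_proj hB hB, P.proj_proj hB hB.compl, P.proj_empty]
  have h2 : P.proj Bᶜ u = 0 := by
    simp [hu, P.proj_proj hB.compl hB.compl, P.proj_proj hB.compl hB, P.proj_empty]
  have h3 := measureReal_add_measureReal_compl (μ := P.scalarMeasure u) hB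
  rw [P.scalarMeasure_real_univ, measureReal_def, measureReal_def, P.scalarMeasure_apply u hB,
    P.scalarMeasure_apply u hB.compl, h1, h2] at h3
  have h4 : u = 0 := by simpa using h3.symm
  exact (sub_eq_zero.mp h4).symm

theorem eq_of_scalarMeasure_eq (h : ∀ v, P.scalarMeasure v = Q.scalarMeasure v)
    (hB : MeasurableSet B) : P.proj B = Q.proj B := by
  have key : (P.proj B : H →ₗ[ℂ] H) = Q.proj B := by
    rw [← ext_inner_map]
    intro v
    have h1 := congrArg (fun μ : Measure ℝ => μ.real B) (h v)
    simp only [measureReal_def, scalarMeasure_apply _ _ hB] at h1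
    rw [ENNReal.toReal_ofReal (by positivity), ENNReal.toReal_ofReal (by positivity)] at h1
    simp only [ContinuousLinearMap.coe_coe]
    rw [P.inner_proj_left hB, Q.inner_proj_left hB, P.inner_self_proj hB, Q.inner_self_proj hB, h1]
  exact ContinuousLinearMap.coe_injective key

namespace IsSpectralMeasureOf

variable {P Q}

theorem integrable_id (h : P.IsSpectralMeasureOf A) {v : H} (hv : v ∈ A.domain) :
    Integrable (fun t : ℝ => t) (P.scalarMeasure v) := by
  refine (((h.1 v).1 hv).add (integrable_const (1 : ℝ))).mono' (by fun_prop) (.of_forall fun t => ?_)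
  rw [Real.norm_eq_abs]
  simp only [Pi.add_apply]
  nlinarith [sq_abs t, sq_nonneg (|t| - 1), abs_nonneg t]

theorem proj_mem_domain (h : P.IsSpectralMeasureOf A) (hB : MeasurableSet B) {v : H}
    (hv : v ∈ A.domain) : P.proj B v ∈ A.domain := by
  rw [h.1, P.scalarMeasure_proj hB]
  exact ((h.1 v).1 hv).restrict

/-- The spectral projections commute with the operator: by additivity of `∫ t d(P v, v)` in the
set of integration, `A` and `P_B A P_B + P_{Bᶜ} A P_{Bᶜ}` have the same quadratic form. -/
theorem apply_proj (h : P.IsSpectralMeasureOf A) (hA : Dense (A.domain : Set H))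
    (hB : MeasurableSet B) (v : A.domain) :
    A ⟨P.proj B v, h.proj_mem_domain hB v.2⟩ = P.proj B (A v) := by
  -- `R C` is `P_C` as an endomorphism of the domain; `S = A - P_B A P_B - P_{Bᶜ} A P_{Bᶜ}`.
  let R (C : Set ℝ) (hC : MeasurableSet C) : A.domain →ₗ[ℂ] A.domain :=
    (P.proj C : H →ₗ[ℂ] H).restrict fun w hw => h.proj_mem_domain hC hw
  have hR (C : Set ℝ) (hC : MeasurableSet C) (w : A.domain) : (R C hC w : H) = P.proj C w := rfl
  let S : A.domain →ₗ[ℂ] H := A.toFun - ((P.proj B : H →ₗ[ℂ] H) ∘ₗ A.toFun ∘ₗ R B hB +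
    (P.proj Bᶜ : H →ₗ[ℂ] H) ∘ₗ A.toFun ∘ₗ R Bᶜ hB.compl)
  have hSapp (w : A.domain) : S w = A w - (P.proj B (A (R B hB w)) +
    P.proj Bᶜ (A (R Bᶜ hB.compl w))) := rfl
  have hS : S = 0 := by
    refine LinearMap.eq_zero_of_inner_self_eq_zero hA S fun w => ?_
    rw [hSapp, inner_sub_right, inner_add_right, ← P.inner_proj_left hB,
      ← P.inner_proj_left hB.compl, ← hR B hB, ← hR Bᶜ hB.compl, h.2, h.2, h.2, hR B hB, hR Bᶜ hB.compl,
      P.scalarMeasure_proj hB, P.scalarMeasure_proj hB.compl, sub_eq_zero]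
    norm_cast
    exact (integral_add_compl hB (h.integrable_id w.2)).symm
  have h0 (w : A.domain) : A w = P.proj B (A (R B hB w)) + P.proj Bᶜ (A (R Bᶜ hB.compl w)) := by
    rw [← sub_eq_zero, ← hSapp, hS]; rfl
  have h1 : P.proj B (A v) = P.proj B (A (R B hB v)) := by
    conv_lhs => rw [h0 v]
    simp [P.proj_proj hB hB, P.proj_proj hB hB.compl, P.proj_empty]
  have h2 : R Bᶜ hB.compl (R B hB v) = 0 := by
    ext; simp [hR, P.proj_proj hB.compl hB, P.proj_empty]
  have h3 : R B hB (R B hB v) = R B hB v := by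
    ext; simp [hR, P.proj_proj hB hB]
  have h4 := h0 (R B hB v)
  rw [h2, h3, LinearPMap.map_zero, map_zero, add_zero] at h4
  rw [h1, ← h4]
  rfl

/-- A vector of the domain whose spectral support lies in `(-∞, a]` for one spectral measure of `A`
and in `(a, ∞)` for another one vanishes: its quadratic form would be both `≤ a` and `> a`. -/
theorem eq_zero_of_proj_Iic_of_proj_Ioi (h : P.IsSpectralMeasureOf A)
    (h' : Q.IsSpectralMeasureOf A) (a : ℝ) {v : H} (hv : v ∈ A.domain)
    (h1 : P.proj (Set.Iic a) v = v) (h2 : Q.proj (Set.Ioi a) v = v) : v = 0 := by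
  have hP := h.integrable_id hv
  have hQ := h'.integrable_id hv
  have e1 : ∫ t, t ∂P.scalarMeasure v = ∫ t, t ∂Q.scalarMeasure v := by
    have := (h.2 ⟨v, hv⟩).symm.trans (h'.2 ⟨v, hv⟩)
    exact_mod_cast this
  have e2 : ∫ t, (t - a) ∂P.scalarMeasure v ≤ 0 := by
    rw [← h1, P.scalarMeasure_proj measurableSet_Iic]
    exact setIntegral_nonpos measurableSet_Iic fun t ht => sub_nonpos.2 ht
  have e3 : ∫ t, (t - a) ∂Q.scalarMeasure v = ∫ t, (t - a) ∂P.scalarMeasure v := by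
    rw [integral_sub hP (integrable_const a), integral_sub hQ (integrable_const a), e1,
      integral_const, integral_const, P.scalarMeasure_real_univ, Q.scalarMeasure_real_univ]
  have e4 : ∫ t in Set.Ioi a, (t - a) ∂Q.scalarMeasure v ≤ 0 := by
    rw [← Q.scalarMeasure_proj measurableSet_Ioi, h2, e3]
    exact e2
  have e5 := setIntegral_pos_iff_support_of_nonneg_ae (μ := Q.scalarMeasure v) (s := Set.Ioi a)
    (f := fun t => t - a)
    ((ae_restrict_iff' measurableSet_Ioi).2 (.of_forall fun t ht => (sub_pos.2 ht).le))
    (hQ.sub (integrable_const a)).integrableOn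
  have e6 : Q.scalarMeasure v (Function.support (fun t => t - a) ∩ Set.Ioi a) = 0 := by
    by_contra hne
    exact e4.not_gt (e5.2 (pos_iff_ne_zero.2 hne))
  have e7 : Function.support (fun t => t - a) ∩ Set.Ioi a = Set.Ioi a :=
    Set.inter_eq_right.2 fun t ht => (sub_pos.2 ht).ne'
  rw [e7, Q.scalarMeasure_apply v measurableSet_Ioi, h2] at e6
  simpa using e6

theorem proj_Iic_mul_proj_Ioi (h : P.IsSpectralMeasureOf A) (h' : Q.IsSpectralMeasureOf A)
    (hA : Dense (A.domain : Set H))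
    (hc : ∀ B C, MeasurableSet B → MeasurableSet C → Commute (P.proj B) (Q.proj C)) (a : ℝ) :
    P.proj (Set.Iic a) * Q.proj (Set.Ioi a) = 0 := by
  refine DFunLike.coe_injective (Continuous.ext_on hA (ContinuousLinearMap.continuous _)
    (ContinuousLinearMap.continuous _) fun v hv => ?_)
  refine h.eq_zero_of_proj_Iic_of_proj_Ioi h' a (h.proj_mem_domain measurableSet_Iic
    (h'.proj_mem_domain measurableSet_Ioi hv)) (P.proj_proj_self measurableSet_Iic _) ?_
  have hcomm (w : H) : P.proj (Set.Iic a) (Q.proj (Set.Ioi a) w) =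
      Q.proj (Set.Ioi a) (P.proj (Set.Iic a) w) :=
    DFunLike.congr_fun (hc _ _ measurableSet_Iic measurableSet_Ioi).eq w
  change Q.proj (Set.Ioi a) (P.proj (Set.Iic a) (Q.proj (Set.Ioi a) v)) =
    P.proj (Set.Iic a) (Q.proj (Set.Ioi a) v)
  rw [hcomm, Q.proj_proj_self measurableSet_Ioi]

/-- Two commuting spectral measures of the same densely defined operator coincide. -/
theorem unique_of_commute (h : P.IsSpectralMeasureOf A) (h' : Q.IsSpectralMeasureOf A)
    (hA : Dense (A.domain : Set H))
    (hc : ∀ B C, MeasurableSet B → MeasurableSet C → Commute (P.proj B) (Q.proj C))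
    (hB : MeasurableSet B) : P.proj B = Q.proj B := by
  have half (P Q : ProjectionValuedMeasure H) (h : P.IsSpectralMeasureOf A)
      (h' : Q.IsSpectralMeasureOf A)
      (hc : ∀ B C, MeasurableSet B → MeasurableSet C → Commute (P.proj B) (Q.proj C)) (a : ℝ) :
      P.proj (Set.Iic a) = P.proj (Set.Iic a) * Q.proj (Set.Iic a) := by
    ext v
    conv_lhs => rw [← Q.proj_add_proj_compl measurableSet_Iic (B := Set.Iic a) v, Set.compl_Iic]
    have h0 := DFunLike.congr_fun (h.proj_Iic_mul_proj_Ioi h' hA hc a) v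
    simp only [mul_apply_eq_comp, zero_apply] at h0
    rw [map_add, h0, add_zero, mul_apply_eq_comp]
  -- By commutativity both projections equal their product.
  have hIic (a : ℝ) : P.proj (Set.Iic a) = Q.proj (Set.Iic a) := by
    rw [half P Q h h' hc a, (hc _ _ measurableSet_Iic measurableSet_Iic).eq]
    exact (half Q P h' h (fun B C hB hC => (hc C B hC hB).symm) a).symm
  refine P.eq_of_scalarMeasure_eq Q (fun v => Measure.ext_of_Iic _ _ fun a => ?_) hB
  rw [P.scalarMeasure_apply v measurableSet_Iic, Q.scalarMeasure_apply v measurableSet_Iic, hIic]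

end IsSpectralMeasureOf

end ProjectionValuedMeasure

end Uniqueness

/-! ### Essential self-adjointness -/

section SelfAdjoint

open LinearPMap

variable {H : Type*} [NormedAddCommGroup H] [InnerProductSpace ℂ H] [CompleteSpace H]

/-- If the adjoint of a densely defined symmetric operator is symmetric, then it is the closure:
in `H × H`, a vector orthogonal to the graph of `T` is, up to a rotation, in the graph of `T†`, hence
by symmetry orthogonal to the graph of `T†`. -/
theorem LinearPMap.closure_eq_adjoint {T : H →ₗ.[ℂ] H} (hd : Dense (T.domain : Set H))
    (hs : T.IsFormalAdjoint T) (ha : T†.IsFormalAdjoint T†) :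
    T.IsClosable ∧ T.closure = T† := by
  have hle : T ≤ T† := hs.le_adjoint hd
  have hcl : T.IsClosable := isClosable_iff_exists_closed_extension.2 ⟨T†, adjoint_isClosed hd, hle⟩
  refine ⟨hcl, eq_of_eq_graph ?_⟩
  rw [← hcl.graph_closure_eq_closure_graph]
  refine le_antisymm (Submodule.topologicalClosure_minimal _ (le_graph_iff.2 hle)
    (adjoint_isClosed hd)) ?_
  rintro ⟨x, y⟩ hxy
  let e := WithLp.prodContinuousLinearEquiv 2 ℂ H H
  let G : Submodule ℂ (WithLp 2 (H × H)) := T.graph.map (e.symm : H × H →ₗ[ℂ] WithLp 2 (H × H))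
  have hmem : e.symm (x, y) ∈ Gᗮᗮ := by
    rw [Submodule.mem_orthogonal]
    intro z hz
    obtain ⟨⟨a, b⟩, rfl⟩ := e.symm.surjective z
    have horth (u : T.domain) : ⟪-a, (u : H)⟫_ℂ = ⟪b, T u⟫_ℂ := by
      have h1 := Submodule.inner_left_of_mem_orthogonal
        (Submodule.mem_map_of_mem (f := (e.symm : H × H →ₗ[ℂ] WithLp 2 (H × H))) (T.mem_graph u)) hz
      have h2 : ⟪a, (u : H)⟫_ℂ + ⟪b, T u⟫_ℂ = 0 := by
        rw [← h1]; exact (WithLp.prod_inner_apply (e.symm (a, b)) (e.symm ((u : H), T u))).symm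
      rw [inner_neg_left]
      linear_combination -h2
    have hb : b ∈ T†.domain := mem_adjoint_domain_of_exists b ⟨-a, horth⟩
    have hTb : T† ⟨b, hb⟩ = -a := adjoint_apply_eq hd ⟨b, hb⟩ horth
    obtain ⟨hx, hy⟩ := (mem_graph_iff' _).1 hxy
    have h3 := ha ⟨b, hb⟩ hx
    obtain ⟨rfl, rfl⟩ := Prod.ext_iff.1 hy
    rw [hTb, inner_neg_left] at h3
    calc ⟪e.symm (a, b), e.symm ((hx : H), T† hx)⟫_ℂ
        = ⟪a, (hx : H)⟫_ℂ + ⟪b, T† hx⟫_ℂ := WithLp.prod_inner_apply (e.symm (a, b)) (e.symm ((hx : H), T† hx))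
      _ = 0 := by rw [← h3]; ring
  rw [Submodule.orthogonal_orthogonal_eq_closure] at hmem
  have h5 : e.symm (x, y) ∈ _root_.closure (e.symm '' (T.graph : Set (H × H))) := hmem
  rw [← e.symm.image_closure] at h5
  obtain ⟨q, hq, hqe⟩ := h5
  rw [← e.symm.injective hqe]
  exact hq

theorem isEssentiallySelfAdjoint_of_adjoint_symmetric {T : H →ₗ.[ℂ] H}
    (hd : Dense (T.domain : Set H)) (hs : T.IsFormalAdjoint T) (ha : T†.IsFormalAdjoint T†) :
    IsEssentiallySelfAdjoint T := by
  obtain ⟨hcl, heq⟩ := closure_eq_adjoint hd hs ha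
  refine ⟨hcl, ?_⟩
  have hle : T ≤ T† := hs.le_adjoint hd
  have hd' : Dense (T†.domain : Set H) := hd.mono hle.1
  rw [heq, isSelfAdjoint_def]
  refine le_antisymm ?_ (ha.le_adjoint hd')
  refine IsFormalAdjoint.le_adjoint hd fun x y => ?_
  have hx : (x : H) ∈ T†.domain := hle.1 x.2
  have h1 : T x = T† ⟨x, hx⟩ := hle.2 rfl
  rw [h1]
  exact (adjoint_isFormalAdjoint hd').symm ⟨x, hx⟩ y

end SelfAdjoint

/-! ### Determinacy of moments -/

section Moments

open ProbabilityTheory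

variable {μ : Measure ℝ} {k : ℝ → ℝ}

/-- Under exponential integrability the power series of `exp (i s t)` may be integrated termwise. -/
theorem integral_cexp_mul_eq_zero_of_moments
    (hk : ∀ c : ℝ, Integrable (fun t => Real.exp (c * |t|) * k t) μ)
    (h0 : ∀ n : ℕ, ∫ t, t ^ n * k t ∂μ = 0) (s : ℝ) :
    ∫ t, Complex.exp (s * t * Complex.I) * k t ∂μ = 0 := by
  have hkm : AEStronglyMeasurable k μ := by simpa using (hk 0).aestronglyMeasurable
  have hsum (t : ℝ) : HasSum (fun n : ℕ => |s * t| ^ n / n.factorial * |k t|)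
      (Real.exp (|s| * |t|) * |k t|) := by
    rw [← abs_mul, Real.exp_eq_exp_ℝ]
    exact (NormedSpace.expSeries_div_hasSum_exp |s * t|).mul_right _
  have hsum' (t : ℝ) : HasSum (fun n : ℕ => ((s * t * Complex.I) ^ n / n.factorial : ℂ) * k t)
      (Complex.exp (s * t * Complex.I) * k t) := by
    have := NormedSpace.expSeries_div_hasSum_exp (s * t * Complex.I : ℂ)
    rw [← Complex.exp_eq_exp_ℂ] at this
    exact this.mul_right (k t : ℂ)
  have h := hasSum_integral_of_dominated_convergence (μ := μ)
    (F := fun (n : ℕ) (t : ℝ) => ((s * t * Complex.I) ^ n / n.factorial : ℂ) * k t)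
    (f := fun t => Complex.exp (s * t * Complex.I) * k t)
    (fun n t => |s * t| ^ n / n.factorial * |k t|)
    (fun n => (Continuous.aestronglyMeasurable (by fun_prop)).mul
      (Complex.continuous_ofReal.comp_aestronglyMeasurable hkm))
    (fun n => .of_forall fun t => by simp [abs_mul])
    (.of_forall fun t => (hsum t).summable)
    (by
      simp_rw [fun t => (hsum t).tsum_eq]
      refine (hk |s|).abs.congr (.of_forall fun t => ?_)
      simp [abs_mul])
    (.of_forall fun t => hsum' t)
  refine h.unique ?_
  convert hasSum_zero with n
  have e : (fun t : ℝ => ((s * t * Complex.I) ^ n / n.factorial : ℂ) * k t) =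
      fun t : ℝ => ((s * Complex.I) ^ n / n.factorial : ℂ) * ((t ^ n * k t : ℝ) : ℂ) := by
    funext t; push_cast; ring
  rw [e, integral_const_mul, integral_complex_ofReal, h0]
  simp

/-- A function with exponential integrability all of whose moments vanish is zero almost everywhere:
the positive and negative parts define measures with the same characteristic function. -/
theorem ae_eq_zero_of_moments (hk : ∀ c : ℝ, Integrable (fun t => Real.exp (c * |t|) * k t) μ)
    (h0 : ∀ n : ℕ, ∫ t, t ^ n * k t ∂μ = 0) : k =ᵐ[μ] 0 := by
  have hki : Integrable k μ := by simpa using hk 0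
  have hki' : Integrable (fun t => -k t) μ := hki.neg
  have hm : AEMeasurable (fun t => ENNReal.ofReal (k t)) μ := hki.aemeasurable.ennreal_ofReal
  have hm' : AEMeasurable (fun t => ENNReal.ofReal (-k t)) μ := hki'.aemeasurable.ennreal_ofReal
  have := isFiniteMeasure_withDensity_ofReal hki.2
  have := isFiniteMeasure_withDensity_ofReal hki'.2
  have hint {g : ℝ → ℝ} (hg : Integrable g μ) (s : ℝ) :
      Integrable (fun t : ℝ => ((ENNReal.ofReal (g t)).toReal : ℝ) •
        Complex.exp (s * t * Complex.I)) μ := by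
    refine hg.abs.mono' ?_ (.of_forall fun t => ?_)
    · exact hg.aemeasurable.ennreal_ofReal.ennreal_toReal.aestronglyMeasurable.smul
        (Continuous.aestronglyMeasurable (by fun_prop))
    · rw [norm_smul, ← Complex.ofReal_mul, Complex.norm_exp_ofReal_mul_I, mul_one,
        ENNReal.toReal_ofReal', Real.norm_eq_abs, abs_of_nonneg (le_max_right _ _)]
      exact max_le (le_abs_self _) (abs_nonneg _)
  have hmeas : μ.withDensity (fun t => ENNReal.ofReal (k t)) =
      μ.withDensity (fun t => ENNReal.ofReal (-k t)) := by
    refine Measure.ext_of_charFun (funext fun s => ?_)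
    rw [charFun_apply_real, charFun_apply_real,
      integral_withDensity_eq_integral_toReal_smul₀ hm (by simp),
      integral_withDensity_eq_integral_toReal_smul₀ hm' (by simp), ← sub_eq_zero,
      ← integral_sub (hint hki s) (hint hki' s),
      ← integral_cexp_mul_eq_zero_of_moments hk h0 s]
    refine integral_congr_ae (.of_forall fun t => ?_)
    have e : ((ENNReal.ofReal (k t)).toReal - (ENNReal.ofReal (-k t)).toReal : ℝ) = k t := by
      rw [ENNReal.toReal_ofReal', ENNReal.toReal_ofReal', max_zero_sub_max_neg_zero_eq_self]
    have e' := congrArg ((↑) : ℝ → ℂ) e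
    push_cast at e'
    simp only [Complex.real_smul]
    linear_combination Complex.exp (s * t * Complex.I) * e'
  have h1 := (withDensity_eq_iff hm hm' (by
    rw [← setLIntegral_univ, ← withDensity_apply _ .univ]
    exact measure_ne_top _ _)).1 hmeas
  filter_upwards [h1] with t ht
  rcases le_total 0 (k t) with h | h
  · rw [ENNReal.ofReal_of_nonpos (neg_nonpos.2 h)] at ht
    exact le_antisymm (ENNReal.ofReal_eq_zero.1 ht) h
  · rw [ENNReal.ofReal_of_nonpos h] at ht
    exact le_antisymm h (neg_nonpos.1 (ENNReal.ofReal_eq_zero.1 ht.symm))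

end Moments

/-! ### Normalized Hermite polynomials -/

section Hermite

open Polynomial

theorem derivative_hermiteH_succ (n : ℕ) :
    derivative (hermiteH (n + 1)) = C (2 * ((n : ℝ) + 1)) * hermiteH n := by
  induction n using Nat.twoStepInduction with
  | zero => simp [hermiteH]
  | one =>
    simp [hermiteH]
    ring
  | more n ih1 ih2 =>
    rw [hermiteH, derivative_sub, derivative_mul, ih2, derivative_C_mul, derivative_C_mul, ih1,
      derivative_X, hermiteH]
    simp only [C_mul, C_add]
    push_cast
    simp only [C_add, map_natCast, map_one, map_ofNat]
    ring

/-- The Hermite polynomials rescaled to be orthonormal for the standard Gaussian measure: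
`Hₙ(t/√2) / √(2ⁿ n!)`. -/
noncomputable def hermitePoly (n : ℕ) : ℝ[X] :=
  C (√(2 ^ n * n.factorial))⁻¹ * (hermiteH n).comp (C (√2)⁻¹ * X)

theorem inv_sqrt_factorial (n : ℕ) : (√(2 ^ n * n.factorial) : ℝ)⁻¹ =
    √2 * √(n + 1) * (√(2 ^ (n + 1) * (n + 1).factorial))⁻¹ := by
  have : (2 ^ (n + 1) * (n + 1).factorial : ℝ) = 2 * (n + 1) * (2 ^ n * n.factorial) := by
    rw [Nat.factorial_succ]; push_cast; ring
  have h1 : √(2 : ℝ) ≠ 0 := by positivity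
  have h2 : √((n : ℝ) + 1) ≠ 0 := by positivity
  rw [this, Real.sqrt_mul (x := 2 * ((n : ℝ) + 1)) (by positivity),
    Real.sqrt_mul (x := 2) (by positivity), mul_inv, mul_inv_cancel_left₀ (mul_ne_zero h1 h2)]

theorem hermitePoly_zero : hermitePoly 0 = 1 := by
  simp [hermitePoly, hermiteH]

/-- Multiplication by `X` acts on the normalized Hermite polynomials by the Jacobi matrix.
At `n = 0` the last term vanishes because of the factor `√0`, whatever `n - 1` means. -/
theorem X_mul_hermitePoly (n : ℕ) : X * hermitePoly n =
    C √((n : ℝ) + 1) * hermitePoly (n + 1) + C √(n : ℝ) * hermitePoly (n - 1) := by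
  have h2 : (√2 : ℝ) ^ 2 = 2 := Real.sq_sqrt (by norm_num)
  refine Polynomial.funext fun t => ?_
  rcases n with _ | n
  · simp [hermitePoly, hermiteH]
    field_simp
    linear_combination t * h2
  · have hn : (√((n : ℝ) + 1)) ^ 2 = n + 1 := Real.sq_sqrt (by positivity)
    have e1 := inv_sqrt_factorial n
    have e2 := inv_sqrt_factorial (n + 1)
    simp only [hermitePoly, hermiteH, Nat.add_sub_cancel, eval_mul, eval_X, eval_C, eval_add,
      eval_comp, eval_sub]
    obtain ⟨s, rfl⟩ : ∃ s, t = √2 * s := ⟨(√2)⁻¹ * t, by field_simp⟩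
    rw [inv_mul_cancel_left₀ (by positivity)]
    push_cast at e1 e2 ⊢
    generalize √((n : ℝ) + 1) = b₁ at *
    generalize √((n : ℝ) + 1 + 1) = b₂ at *
    generalize (√(2 ^ n * n.factorial))⁻¹ = c₀ at *
    generalize (√(2 ^ (n + 1) * (n + 1).factorial))⁻¹ = c₁ at *
    generalize (√(2 ^ (n + 1 + 1) * (n + 1 + 1).factorial))⁻¹ = c₂ at *
    generalize (hermiteH n).eval s = y₀
    generalize (hermiteH (n + 1)).eval s = y₁
    linear_combination (√2 * s * y₁ - √2 * b₁ ^ 2 * y₀) * e2 - b₁ * y₀ * e1 +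
      (s * b₂ * c₂ * y₁ - b₁ ^ 2 * b₂ * c₂ * y₀) * h2 - 2 * b₂ * c₂ * y₀ * hn

theorem derivative_hermitePoly_succ (n : ℕ) :
    derivative (hermitePoly (n + 1)) = C √((n : ℝ) + 1) * hermitePoly n := by
  have h2 : (√2 : ℝ) ^ 2 = 2 := Real.sq_sqrt (by norm_num)
  have hn : (√((n : ℝ) + 1)) ^ 2 = n + 1 := Real.sq_sqrt (by positivity)
  refine Polynomial.funext fun t => ?_
  rw [hermitePoly, hermitePoly, derivative_C_mul, derivative_comp, derivative_hermiteH_succ,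
    inv_sqrt_factorial n]
  simp only [derivative_C_mul, derivative_X, eval_mul, eval_C, eval_comp, eval_X, eval_one]
  have h3 : (√2 : ℝ)⁻¹ * 2 = √2 := by
    rw [inv_mul_eq_iff_eq_mul₀ (by positivity), ← sq, h2]
  linear_combination ((√(2 ^ (n + 1) * (n + 1).factorial))⁻¹ *
    (hermiteH n).eval ((√2)⁻¹ * t)) * (((n : ℝ) + 1) * h3 - √2 * hn)

end Hermite

/-! ### The Gaussian Hilbert space -/

section Gaussian

open Polynomial ProbabilityTheory

/-- The standard Gaussian measure on the line. -/
noncomputable abbrev gaussianMeasure : Measure ℝ := gaussianReal 0 1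

theorem integrable_eval_mul_exp (p : ℝ[X]) (c : ℝ) :
    Integrable (fun t : ℝ => p.eval t * Real.exp (c * |t|)) gaussianMeasure := by
  induction p using Polynomial.induction_on' with
  | add p q hp hq =>
    simp only [eval_add, add_mul]
    exact hp.add hq
  | monomial n a =>
    have h := integrable_pow_abs_mul_exp_add_of_integrable_exp_mul (X := fun t : ℝ => t)
      (μ := gaussianMeasure) (t := |c| + 1) (v := 0) (x := |c|) (integrable_exp_mul_gaussianReal _)
      (integrable_exp_mul_gaussianReal _) (abs_nonneg c)
      (by rw [abs_of_nonneg (a := |c| + 1) (by positivity)]; linarith) n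
    refine (h.const_mul |a|).mono' (by fun_prop) (.of_forall fun t => ?_)
    simp only [eval_monomial, norm_mul, Real.norm_eq_abs, abs_pow, Real.abs_exp, zero_mul, zero_add]
    rw [mul_assoc]
    gcongr
    exact le_abs_self c

theorem integrable_eval_gaussian (p : ℝ[X]) : Integrable (fun t : ℝ => p.eval t) gaussianMeasure := by
  simpa using integrable_eval_mul_exp p 0

theorem memLp_eval_mul_exp (p : ℝ[X]) (c : ℝ) :
    MemLp (fun t : ℝ => ((p.eval t * Real.exp (c * |t|) : ℝ) : ℂ)) 2 gaussianMeasure := by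
  have hm : AEStronglyMeasurable (fun t : ℝ => p.eval t * Real.exp (c * |t|)) gaussianMeasure := by
    fun_prop
  refine MemLp.ofReal (f := fun t => p.eval t * Real.exp (c * |t|))
    ((memLp_two_iff_integrable_sq hm).2 ?_)
  refine (integrable_eval_mul_exp (p ^ 2) (2 * c)).congr (.of_forall fun t => ?_)
  simp only [eval_pow, mul_pow, ← Real.exp_nat_mul]
  congr 2
  push_cast
  ring

/-- Gaussian integration by parts. -/
theorem integral_X_mul_eval (p : ℝ[X]) :
    ∫ t, (X * p).eval t ∂gaussianMeasure = ∫ t, (derivative p).eval t ∂gaussianMeasure := by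
  have hd (t : ℝ) : HasDerivAt (gaussianPDFReal 0 1) (-t * gaussianPDFReal 0 1 t) t := by
    have : HasDerivAt (fun t : ℝ => -(t - 0) ^ 2 / (2 * ((1 : NNReal) : ℝ))) (-t) t := by
      refine ((((hasDerivAt_id t).sub_const 0).pow 2).neg.div_const _).congr_deriv ?_
      simp
      ring
    refine (this.exp.const_mul (√(2 * Real.pi * ((1 : NNReal) : ℝ)))⁻¹).congr_deriv ?_
    rw [gaussianPDFReal]
    ring
  have hint (q : ℝ[X]) : Integrable (fun t => gaussianPDFReal 0 1 t * q.eval t) := by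
    have h := integrable_eval_gaussian q
    rw [gaussianMeasure, gaussianReal_of_var_ne_zero 0 one_ne_zero,
      integrable_withDensity_iff_integrable_smul' (measurable_gaussianPDF 0 1)
        (.of_forall fun _ => gaussianPDF_lt_top)] at h
    simpa [toReal_gaussianPDF] using h
  have h0 := integral_eq_zero_of_hasDerivAt_of_integrable
    (f := fun t => gaussianPDFReal 0 1 t * p.eval t)
    (f' := fun t => gaussianPDFReal 0 1 t * (derivative p - X * p).eval t)
    (fun t => ((hd t).mul (p.hasDerivAt t)).congr_deriv (by simp; ring)) (hint _) (hint p)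
  have h1 : ∫ t, (derivative p - X * p).eval t ∂gaussianMeasure = 0 := by
    rw [integral_gaussianReal_eq_integral_smul one_ne_zero]
    exact h0
  simp only [eval_sub] at h1
  rw [integral_sub (integrable_eval_gaussian _) (integrable_eval_gaussian _), sub_eq_zero] at h1
  exact h1.symm

theorem integral_hermitePoly_mul (m n : ℕ) :
    ∫ t, (hermitePoly m * hermitePoly n).eval t ∂gaussianMeasure = if m = n then 1 else 0 := by
  -- Integration by parts yields `√(m + 1) ⟪p (m + 1), p n⟫ = ⟪p m, p' n⟫`.
  have step (m n : ℕ) : √((m : ℝ) + 1) * ∫ t, (hermitePoly (m + 1) * hermitePoly n).eval t ∂gaussianMeasure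
      = ∫ t, (hermitePoly m * derivative (hermitePoly n)).eval t ∂gaussianMeasure := by
    have hder : derivative (hermitePoly m) = C √(m : ℝ) * hermitePoly (m - 1) := by
      rcases m with _ | m
      · simp [hermitePoly_zero]
      · simp [derivative_hermitePoly_succ]
    have hpoly : C √((m : ℝ) + 1) * (hermitePoly (m + 1) * hermitePoly n) =
        X * (hermitePoly m * hermitePoly n) - derivative (hermitePoly m) * hermitePoly n := by
      rw [hder, ← mul_assoc X, X_mul_hermitePoly]
      ring
    have h1 := integral_X_mul_eval (hermitePoly m * hermitePoly n)
    have h2 := congrArg (fun q : ℝ[X] => ∫ t, q.eval t ∂gaussianMeasure) hpoly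
    simp only [eval_sub] at h2
    rw [integral_sub (integrable_eval_gaussian _) (integrable_eval_gaussian _), h1, derivative_mul,
      ← integral_sub (integrable_eval_gaussian _) (integrable_eval_gaussian _)] at h2
    simp only [← eval_sub, add_sub_cancel_left] at h2
    rw [← h2, ← integral_const_mul]
    simp only [eval_mul, eval_C]
  have hpos (m : ℕ) : √((m : ℝ) + 1) ≠ 0 := by positivity
  induction m generalizing n with
  | zero =>
    rcases n with _ | n
    · simp [hermitePoly_zero]
    · have h := step n 0
      rw [hermitePoly_zero] at h
      simpa [hermitePoly_zero, hpos] using h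
  | succ m ih =>
    rcases n with _ | n
    · have h := step m 0
      simpa [hermitePoly_zero, hpos] using h
    · refine mul_left_cancel₀ (hpos m) ?_
      rw [step m (n + 1), derivative_hermitePoly_succ]
      have e : ∫ t, (hermitePoly m * (C √((n : ℝ) + 1) * hermitePoly n)).eval t ∂gaussianMeasure =
          √((n : ℝ) + 1) * ∫ t, (hermitePoly m * hermitePoly n).eval t ∂gaussianMeasure := by
        rw [← integral_const_mul]
        refine integral_congr_ae (.of_forall fun t => ?_)
        simp only [eval_mul, eval_C]
        ring
      rw [e, ih n]
      by_cases hmn : m = n <;> simp [hmn]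

/-- Completeness of the Hermite polynomials, in a form that also covers functions which are
polynomial multiples of square integrable ones. -/
theorem ae_eq_zero_of_integral_hermitePoly {k : ℝ → ℂ}
    (hk : ∀ (p : ℝ[X]) (c : ℝ),
      Integrable (fun t => ((p.eval t * Real.exp (c * |t|) : ℝ) : ℂ) * k t) gaussianMeasure)
    (h0 : ∀ n, ∫ t, (((hermitePoly n).eval t : ℝ) : ℂ) * k t ∂gaussianMeasure = 0) : k =ᵐ[gaussianMeasure] 0 := by
  have hp (p : ℝ[X]) : Integrable (fun t => ((p.eval t : ℝ) : ℂ) * k t) gaussianMeasure := by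
    simpa using hk p 0
  -- The span of the Hermite polynomials is stable under multiplication by `X`, so it has all powers.
  have hX (m : ℕ) : ∀ n, ∫ t, (((X ^ m * hermitePoly n).eval t : ℝ) : ℂ) * k t ∂gaussianMeasure = 0 := by
    induction m with
    | zero => simpa using h0
    | succ m ih =>
      intro n
      have e (t : ℝ) : (((X ^ (m + 1) * hermitePoly n).eval t : ℝ) : ℂ) * k t =
          √((n : ℝ) + 1) * ((((X ^ m * hermitePoly (n + 1)).eval t : ℝ) : ℂ) * k t) +
          √(n : ℝ) * ((((X ^ m * hermitePoly (n - 1)).eval t : ℝ) : ℂ) * k t) := by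
        rw [pow_succ, mul_assoc, X_mul_hermitePoly]
        simp only [eval_mul, eval_add, eval_C]
        push_cast
        ring
      simp_rw [e]
      rw [integral_add ((hp _).const_mul _) ((hp _).const_mul _), integral_const_mul,
        integral_const_mul, ih, ih, mul_zero, mul_zero, add_zero]
  have hmom (n : ℕ) : ∫ t, ((t ^ n : ℝ) : ℂ) * k t ∂gaussianMeasure = 0 := by
    simpa [hermitePoly_zero] using hX n 0
  have hmi (n : ℕ) : Integrable (fun t => ((t ^ n : ℝ) : ℂ) * k t) gaussianMeasure := by
    simpa using hp (X ^ n)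
  have hei (c : ℝ) : Integrable (fun t => ((Real.exp (c * |t|) : ℝ) : ℂ) * k t) gaussianMeasure := by
    simpa using hk 1 c
  have hre : (fun t => (k t).re) =ᵐ[gaussianMeasure] 0 := by
    refine ae_eq_zero_of_moments (fun c => ?_) fun n => ?_
    · simpa only [RCLike.re_eq_complex_re, Complex.re_ofReal_mul] using (hei c).re
    · have h := integral_re (hmi n)
      rw [hmom] at h
      simpa only [RCLike.re_eq_complex_re, Complex.re_ofReal_mul, Complex.zero_re] using h
  have him : (fun t => (k t).im) =ᵐ[gaussianMeasure] 0 := by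
    refine ae_eq_zero_of_moments (fun c => ?_) fun n => ?_
    · simpa only [RCLike.im_eq_complex_im, Complex.im_ofReal_mul] using (hei c).im
    · have h := integral_im (hmi n)
      rw [hmom] at h
      simpa only [RCLike.im_eq_complex_im, Complex.im_ofReal_mul, Complex.zero_im] using h
  filter_upwards [hre, him] with t h1 h2
  exact Complex.ext h1 h2

/-- The Hilbert space of functions that are square integrable for the standard Gaussian measure. -/
abbrev GaussianL2 : Type := Lp ℂ 2 gaussianMeasure

theorem integrable_eval_mul_exp_mul (f : GaussianL2) (p : ℝ[X]) (c : ℝ) :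
    Integrable (fun t => ((p.eval t * Real.exp (c * |t|) : ℝ) : ℂ) * f t) gaussianMeasure :=
  (memLp_eval_mul_exp p c).integrable_mul (Lp.memLp f)

theorem memLp_hermitePoly (n : ℕ) :
    MemLp (fun t : ℝ => (((hermitePoly n).eval t : ℝ) : ℂ)) 2 gaussianMeasure := by
  simpa using memLp_eval_mul_exp (hermitePoly n) 0

/-- The normalized Hermite polynomial as an element of the Gaussian Hilbert space. -/
noncomputable def hermiteLp (n : ℕ) : GaussianL2 := (memLp_hermitePoly n).toLp

theorem coeFn_hermiteLp (n : ℕ) :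
    hermiteLp n =ᵐ[gaussianMeasure] fun t : ℝ => (((hermitePoly n).eval t : ℝ) : ℂ) :=
  (memLp_hermitePoly n).coeFn_toLp

theorem inner_hermiteLp (n : ℕ) (f : GaussianL2) :
    ⟪hermiteLp n, f⟫_ℂ = ∫ t, (((hermitePoly n).eval t : ℝ) : ℂ) * f t ∂gaussianMeasure := by
  rw [L2.inner_def]
  refine integral_congr_ae ?_
  filter_upwards [coeFn_hermiteLp n] with t ht
  rw [ht, RCLike.inner_apply, Complex.conj_ofReal, mul_comm]

theorem orthonormal_hermiteLp : Orthonormal ℂ hermiteLp := by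
  rw [orthonormal_iff_ite]
  intro m n
  rw [inner_hermiteLp]
  have e : ∫ t, (((hermitePoly m).eval t : ℝ) : ℂ) * hermiteLp n t ∂gaussianMeasure =
      ∫ t, (((hermitePoly m * hermitePoly n).eval t : ℝ) : ℂ) ∂gaussianMeasure := by
    refine integral_congr_ae ?_
    filter_upwards [coeFn_hermiteLp n] with t ht
    rw [ht, eval_mul, Complex.ofReal_mul]
  rw [e, integral_complex_ofReal, integral_hermitePoly_mul]
  split_ifs <;> simp

theorem eq_zero_of_inner_hermiteLp {f : GaussianL2} (h : ∀ n, ⟪hermiteLp n, f⟫_ℂ = 0) : f = 0 := by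
  refine (Lp.eq_zero_iff_ae_eq_zero).2
    (ae_eq_zero_of_integral_hermitePoly (integrable_eval_mul_exp_mul f) fun n => ?_)
  rw [← inner_hermiteLp, h]

/-- The Hilbert basis of normalized Hermite polynomials. -/
noncomputable def hermiteBasis : HilbertBasis ℕ ℂ GaussianL2 :=
  HilbertBasis.mkOfOrthogonalEqBot orthonormal_hermiteLp <| by
    rw [eq_bot_iff]
    intro f hf
    refine (Submodule.mem_bot ℂ).2 (eq_zero_of_inner_hermiteLp fun n => ?_)
    exact Submodule.inner_right_of_mem_orthogonal (Submodule.subset_span (Set.mem_range_self n)) hf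

theorem hermiteBasis_apply (n : ℕ) : hermiteBasis n = hermiteLp n := by
  simp [hermiteBasis]

end Gaussian

/-! ### The operator as multiplication by the variable -/

section Model

open Polynomial
open scoped LinearPMap

theorem hermiteOperator_deltaVec (n : ℕ) (hn : deltaVec n ∈ hermiteOperator.domain) :
    hermiteOperator ⟨deltaVec n, hn⟩ =
      (√((n : ℝ) + 1) : ℂ) • deltaVec (n + 1) + (√(n : ℝ) : ℂ) • deltaVec (n - 1) := by
  ext x
  have h1 : (hermiteOperator ⟨deltaVec n, hn⟩) x =
      ∑ᶠ y : ℕ, (hermiteMatrix x y : ℂ) * deltaVec n y := rfl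
  rw [h1, finsum_eq_single _ n (fun y hy => by simp [deltaVec, lp.single_apply, hy])]
  simp only [deltaVec, lp.coeFn_add, lp.coeFn_smul, Pi.add_apply, Pi.smul_apply, lp.single_apply,
    smul_eq_mul, hermiteMatrix, Pi.single_apply]
  rcases n with _ | n
  · rcases x with _ | x
    · simp
    · by_cases h : x = 0 <;> simp [h]
  · by_cases h2 : x = n
    · subst h2
      have h3 : x ≠ x + 1 + 1 := by omega
      simp [h3]
    · by_cases h3 : x = n + 1 + 1
      · subst h3
        have h4 : n + 1 + 1 ≠ n := by omega
        simp [h4]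
      · have h4 : n ≠ x := Ne.symm h2
        simp [h2, h3, h4]

theorem deltaVec_mem (n : ℕ) : deltaVec n ∈ hermiteOperator.domain :=
  Submodule.subset_span (Set.mem_range_self n)

/-- The unitary from `ℓ²` onto the Gaussian Hilbert space that maps the standard basis vectors to
the normalized Hermite polynomials. -/
noncomputable def gaussianEquiv : EllTwo ≃ₗᵢ[ℂ] GaussianL2 := hermiteBasis.repr.symm

theorem gaussianEquiv_deltaVec (n : ℕ) : gaussianEquiv (deltaVec n) = hermiteLp n := by
  rw [← hermiteBasis_apply]
  exact hermiteBasis.repr_symm_single n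

theorem coeFn_gaussianEquiv_deltaVec (n : ℕ) : gaussianEquiv (deltaVec n) =ᵐ[gaussianMeasure]
    fun t : ℝ => (((hermitePoly n).eval t : ℝ) : ℂ) := by
  rw [gaussianEquiv_deltaVec]
  exact coeFn_hermiteLp n

theorem inner_eq_integral (v w : EllTwo) :
    ⟪v, w⟫_ℂ = ∫ t, starRingEnd ℂ (gaussianEquiv v t) * gaussianEquiv w t ∂gaussianMeasure := by
  rw [← gaussianEquiv.inner_map_map, L2.inner_def]
  simp only [RCLike.inner_apply, mul_comm]

theorem inner_deltaVec_eq_integral (n : ℕ) (v : EllTwo) : ⟪deltaVec n, v⟫_ℂ =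
    ∫ t, (((hermitePoly n).eval t : ℝ) : ℂ) * gaussianEquiv v t ∂gaussianMeasure := by
  rw [← gaussianEquiv.inner_map_map, gaussianEquiv_deltaVec, inner_hermiteLp]

theorem norm_sq_eq_integral (v : EllTwo) :
    ‖v‖ ^ 2 = ∫ t, ‖gaussianEquiv v t‖ ^ 2 ∂gaussianMeasure := by
  have h := inner_eq_integral v v
  simp only [Complex.conj_mul', inner_self_eq_norm_sq_to_K] at h
  norm_cast at h
  exact Complex.ofReal_injective h

theorem integrable_norm_sq (v : EllTwo) :
    Integrable (fun t => ‖gaussianEquiv v t‖ ^ 2) gaussianMeasure :=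
  (Lp.memLp (gaussianEquiv v)).integrable_norm_pow two_ne_zero

theorem ext_inner_deltaVec {v w : EllTwo} (h : ∀ n, ⟪deltaVec n, v⟫_ℂ = ⟪deltaVec n, w⟫_ℂ) :
    v = w := by
  refine gaussianEquiv.injective (sub_eq_zero.1 (eq_zero_of_inner_hermiteLp fun n => ?_))
  rw [← gaussianEquiv_deltaVec, inner_sub_right, gaussianEquiv.inner_map_map,
    gaussianEquiv.inner_map_map, h, sub_self]

theorem dense_hermiteOperator_domain : Dense (hermiteOperator.domain : Set EllTwo) := by
  refine (Submodule.dense_iff_topologicalClosure_eq_top).2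
    ((Submodule.topologicalClosure_eq_top_iff).2 ((Submodule.eq_bot_iff _).2 fun v hv => ?_))
  refine ext_inner_deltaVec fun n => ?_
  rw [inner_zero_right]
  exact Submodule.inner_right_of_mem_orthogonal (deltaVec_mem n) hv

theorem gaussianEquiv_hermiteOperator (u : hermiteOperator.domain) :
    gaussianEquiv (hermiteOperator u) =ᵐ[gaussianMeasure] fun t : ℝ => t * gaussianEquiv u t := by
  obtain ⟨u, hu⟩ := u
  induction hu using Submodule.span_induction with
  | mem v hv =>
    obtain ⟨n, rfl⟩ := hv
    change gaussianEquiv (hermiteOperator ⟨deltaVec n, deltaVec_mem n⟩) =ᵐ[gaussianMeasure]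
      fun t : ℝ => t * gaussianEquiv (deltaVec n) t
    rw [hermiteOperator_deltaVec, map_add, map_smul, map_smul]
    filter_upwards [Lp.coeFn_add ((√((n : ℝ) + 1) : ℂ) • gaussianEquiv (deltaVec (n + 1)))
      ((√(n : ℝ) : ℂ) • gaussianEquiv (deltaVec (n - 1))),
      Lp.coeFn_smul (√((n : ℝ) + 1) : ℂ) (gaussianEquiv (deltaVec (n + 1))),
      Lp.coeFn_smul (√(n : ℝ) : ℂ) (gaussianEquiv (deltaVec (n - 1))),
      coeFn_gaussianEquiv_deltaVec n, coeFn_gaussianEquiv_deltaVec (n + 1),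
      coeFn_gaussianEquiv_deltaVec (n - 1)] with t h1 h2 h3 h4 h5 h6
    have h7 := congrArg (fun p : ℝ[X] => ((p.eval t : ℝ) : ℂ)) (X_mul_hermitePoly n)
    simp only [eval_mul, eval_add, eval_X, eval_C] at h7
    push_cast at h7
    rw [h1, Pi.add_apply, h2, h3, Pi.smul_apply, Pi.smul_apply, h4, h5, h6, h7]
    rfl
  | zero =>
    have h0 : hermiteOperator ⟨0, zero_mem _⟩ = 0 := hermiteOperator.map_zero
    rw [h0, map_zero]
    exact .of_forall fun t => by simp
  | add v w hv hw ihv ihw =>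
    have h0 : hermiteOperator ⟨v + w, add_mem hv hw⟩ =
      hermiteOperator ⟨v, hv⟩ + hermiteOperator ⟨w, hw⟩ := hermiteOperator.map_add ⟨v, hv⟩ ⟨w, hw⟩
    rw [h0, map_add]
    filter_upwards [ihv, ihw, Lp.coeFn_add (gaussianEquiv v) (gaussianEquiv w),
      Lp.coeFn_add (gaussianEquiv (hermiteOperator ⟨v, hv⟩))
        (gaussianEquiv (hermiteOperator ⟨w, hw⟩))] with t h1 h2 h3 h4
    rw [h4, Pi.add_apply, h1, h2, map_add, h3, Pi.add_apply, mul_add]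
  | smul a v hv ihv =>
    have h0 : hermiteOperator ⟨a • v, Submodule.smul_mem _ a hv⟩ =
      a • hermiteOperator ⟨v, hv⟩ := hermiteOperator.map_smul a ⟨v, hv⟩
    rw [h0, map_smul]
    filter_upwards [ihv, Lp.coeFn_smul a (gaussianEquiv v),
      Lp.coeFn_smul a (gaussianEquiv (hermiteOperator ⟨v, hv⟩))] with t h1 h2 h3
    rw [h3, Pi.smul_apply, h1, map_smul, h2, Pi.smul_apply, smul_eq_mul, smul_eq_mul]
    ring

/-- Multiplication by the real variable is symmetric. -/
theorem inner_comm_of_ae_eq_mul {v v' w w' : EllTwo}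
    (h : gaussianEquiv w =ᵐ[gaussianMeasure] fun t : ℝ => t * gaussianEquiv v t)
    (h' : gaussianEquiv w' =ᵐ[gaussianMeasure] fun t : ℝ => t * gaussianEquiv v' t) :
    ⟪w, v'⟫_ℂ = ⟪v, w'⟫_ℂ := by
  rw [inner_eq_integral, inner_eq_integral]
  refine integral_congr_ae ?_
  filter_upwards [h, h'] with t h1 h2
  rw [h1, h2, map_mul, Complex.conj_ofReal]
  ring

/-- The adjoint acts as multiplication by the variable: the difference of the two sides is
orthogonal to all Hermite polynomials. -/
theorem gaussianEquiv_adjoint (v : hermiteOperator†.domain) :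
    gaussianEquiv (hermiteOperator† v) =ᵐ[gaussianMeasure] fun t : ℝ => t * gaussianEquiv v t := by
  have hint (p : ℝ[X]) (c : ℝ) :
      Integrable (fun t : ℝ => ((p.eval t * Real.exp (c * |t|) : ℝ) : ℂ) * (t * gaussianEquiv v t))
        gaussianMeasure := by
    refine (integrable_eval_mul_exp_mul (gaussianEquiv v) (X * p) c).congr (.of_forall fun t => ?_)
    simp only [eval_mul, eval_X]
    push_cast
    ring
  have hint' := integrable_eval_mul_exp_mul (gaussianEquiv (hermiteOperator† v))
  have hz := ae_eq_zero_of_integral_hermitePoly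
    (k := fun t : ℝ => gaussianEquiv (hermiteOperator† v) t - t * gaussianEquiv v t)
    (fun p c => by
      simp only [mul_sub]
      exact (hint' p c).sub (hint p c))
    (fun n => by
      have h1 := (LinearPMap.adjoint_isFormalAdjoint dense_hermiteOperator_domain).symm ⟨_, deltaVec_mem n⟩ v
      have h2 : ⟪hermiteOperator ⟨_, deltaVec_mem n⟩, (v : EllTwo)⟫_ℂ =
          ∫ t : ℝ, (((hermitePoly n).eval t : ℝ) : ℂ) * (t * gaussianEquiv v t)
            ∂gaussianMeasure := by
        rw [inner_eq_integral]
        refine integral_congr_ae ?_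
        filter_upwards [gaussianEquiv_hermiteOperator ⟨_, deltaVec_mem n⟩,
          coeFn_gaussianEquiv_deltaVec n] with t h3 h4
        rw [h3, h4, map_mul, Complex.conj_ofReal, Complex.conj_ofReal]
        ring
      rw [h2, inner_deltaVec_eq_integral] at h1
      simp only [mul_sub]
      rw [integral_sub, h1, sub_self]
      · simpa using hint' (hermitePoly n) 0
      · simpa using hint (hermitePoly n) 0)
  filter_upwards [hz] with t ht
  exact sub_eq_zero.1 ht

theorem hermiteOperator_symmetric : hermiteOperator.IsFormalAdjoint hermiteOperator := fun u v =>
  inner_comm_of_ae_eq_mul (gaussianEquiv_hermiteOperator u) (gaussianEquiv_hermiteOperator v)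

theorem hermiteOperator_adjoint_symmetric :
    hermiteOperator†.IsFormalAdjoint hermiteOperator† := fun u v =>
  inner_comm_of_ae_eq_mul (gaussianEquiv_adjoint u) (gaussianEquiv_adjoint v)

theorem hermiteOperator_closure : hermiteOperator.closure = hermiteOperator† :=
  (LinearPMap.closure_eq_adjoint dense_hermiteOperator_domain hermiteOperator_symmetric
    hermiteOperator_adjoint_symmetric).2

theorem dense_hermiteOperator_closure_domain :
    Dense (hermiteOperator.closure.domain : Set EllTwo) :=
  dense_hermiteOperator_domain.mono hermiteOperator.le_closure.1

theorem gaussianEquiv_hermiteOperator_closure (v : hermiteOperator.closure.domain) :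
    gaussianEquiv (hermiteOperator.closure v) =ᵐ[gaussianMeasure]
      fun t : ℝ => t * gaussianEquiv v t := by
  obtain ⟨v, hv⟩ := v
  have h := gaussianEquiv_adjoint ⟨v, hermiteOperator_closure ▸ hv⟩
  rwa [show hermiteOperator.closure ⟨v, hv⟩ = hermiteOperator† ⟨v, hermiteOperator_closure ▸ hv⟩ from
    hermiteOperator_closure.le.2 rfl]

theorem mem_hermiteOperator_closure_domain_iff (v : EllTwo) :
    v ∈ hermiteOperator.closure.domain ↔
      MemLp (fun t : ℝ => t * gaussianEquiv v t) 2 gaussianMeasure := by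
  refine ⟨fun hv => (memLp_congr_ae (gaussianEquiv_hermiteOperator_closure ⟨v, hv⟩)).1
    (Lp.memLp _), fun hv => ?_⟩
  rw [hermiteOperator_closure]
  refine LinearPMap.mem_adjoint_domain_of_exists v ⟨gaussianEquiv.symm hv.toLp, fun u => ?_⟩
  refine inner_comm_of_ae_eq_mul ?_ (gaussianEquiv_hermiteOperator u)
  rw [gaussianEquiv.apply_symm_apply]
  exact hv.coeFn_toLp

end Model

/-! ### The spectral measure of multiplication by the variable -/

section HermitePVM

/-- A series of pairwise orthogonal vectors converges to `x` as soon as its terms are the components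
of `x` along them and account for the whole norm of `x`. -/
theorem hasSum_of_orthogonal {H : Type*} [NormedAddCommGroup H] [InnerProductSpace ℂ H]
    {ι : Type*} {x : H} {y : ι → H} (h1 : Pairwise fun i j => ⟪y i, y j⟫_ℂ = 0)
    (h2 : ∀ i, ⟪x, y i⟫_ℂ = ((‖y i‖ ^ 2 : ℝ) : ℂ))
    (h3 : HasSum (fun i => ‖y i‖ ^ 2) (‖x‖ ^ 2)) : HasSum y x := by
  classical
  have key (s : Finset ι) : ‖(∑ i ∈ s, y i) - x‖ ^ 2 = ‖x‖ ^ 2 - ∑ i ∈ s, ‖y i‖ ^ 2 := by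
    induction s using Finset.induction_on with
    | empty => simp
    | insert j s hj ih =>
      have h4 : ⟪(∑ i ∈ s, y i) - x, y j⟫_ℂ = -((‖y j‖ ^ 2 : ℝ) : ℂ) := by
        rw [inner_sub_left, sum_inner, h2,
          Finset.sum_eq_zero fun i hi => h1 fun h : i = j => hj (h ▸ hi), zero_sub]
      rw [Finset.sum_insert hj, Finset.sum_insert hj,
        show y j + ∑ i ∈ s, y i - x = (∑ i ∈ s, y i - x) + y j by abel,
        @norm_add_sq ℂ, h4, ih, ← Complex.ofReal_neg, RCLike.re_eq_complex_re, Complex.ofReal_re]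
      ring
  rw [HasSum, tendsto_iff_norm_sub_tendsto_zero]
  have h5 : Filter.Tendsto (fun s : Finset ι => √(‖x‖ ^ 2 - ∑ i ∈ s, ‖y i‖ ^ 2)) Filter.atTop
      (nhds (√(‖x‖ ^ 2 - ‖x‖ ^ 2))) :=
    (Real.continuous_sqrt.tendsto _).comp (tendsto_const_nhds.sub h3)
  rw [sub_self, Real.sqrt_zero] at h5
  refine h5.congr fun s => ?_
  rw [← key, Real.sqrt_sq (norm_nonneg _)]

/-- Multiplication by the indicator function of a measurable set. -/
noncomputable def indicatorCLM {B : Set ℝ} (hB : MeasurableSet B) :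
    GaussianL2 →L[ℂ] GaussianL2 :=
  LinearMap.mkContinuous
    { toFun := fun f => ((Lp.memLp f).indicator hB).toLp
      map_add' := fun f g => by
        rw [← MemLp.toLp_add]
        refine MemLp.toLp_congr _ _ ?_
        filter_upwards [Lp.coeFn_add f g] with t ht
        by_cases h : t ∈ B
        · simpa [h] using ht
        · simp [h]
      map_smul' := fun a f => by
        rw [RingHom.id_apply, ← MemLp.toLp_const_smul]
        refine MemLp.toLp_congr _ _ ?_
        filter_upwards [Lp.coeFn_smul a f] with t ht
        by_cases h : t ∈ B
        · simpa [h] using ht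
        · simp [h] } 1
    fun f => by
      rw [one_mul]
      refine Lp.norm_le_norm_of_ae_le ?_
      filter_upwards [((Lp.memLp f).indicator hB).coeFn_toLp] with t ht
      exact ht ▸ norm_indicator_le_norm_self _ _

theorem coeFn_indicatorCLM {B : Set ℝ} (hB : MeasurableSet B) (f : GaussianL2) :
    indicatorCLM hB f =ᵐ[gaussianMeasure] B.indicator f :=
  ((Lp.memLp f).indicator hB).coeFn_toLp

open Classical in
/-- The spectral projection of a Borel set, transported from the Gaussian Hilbert space, where it is
multiplication by the indicator function. Other sets are sent to `0`. -/
noncomputable def hermiteProj (B : Set ℝ) : EllTwo →L[ℂ] EllTwo :=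
  if hB : MeasurableSet B then
    (gaussianEquiv.symm : GaussianL2 →L[ℂ] EllTwo) ∘L indicatorCLM hB ∘L
      (gaussianEquiv : EllTwo →L[ℂ] GaussianL2)
  else 0

variable {B C : Set ℝ}

theorem gaussianEquiv_hermiteProj (hB : MeasurableSet B) (v : EllTwo) :
    gaussianEquiv (hermiteProj B v) =ᵐ[gaussianMeasure] B.indicator (gaussianEquiv v) := by
  have h : gaussianEquiv (hermiteProj B v) = indicatorCLM hB (gaussianEquiv v) := by
    rw [hermiteProj, dif_pos hB]
    exact gaussianEquiv.apply_symm_apply _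
  rw [h]
  exact coeFn_indicatorCLM hB _

theorem ext_gaussianEquiv {v w : EllTwo}
    (h : gaussianEquiv v =ᵐ[gaussianMeasure] gaussianEquiv w) : v = w :=
  gaussianEquiv.injective (Lp.ext h)

theorem hermiteProj_hermiteProj (hB : MeasurableSet B) (hC : MeasurableSet C) (v : EllTwo) :
    hermiteProj B (hermiteProj C v) = hermiteProj (B ∩ C) v := by
  refine ext_gaussianEquiv ?_
  filter_upwards [gaussianEquiv_hermiteProj hB (hermiteProj C v), gaussianEquiv_hermiteProj hC v,
    gaussianEquiv_hermiteProj (hB.inter hC) v] with t h1 h2 h3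
  rw [h1, h3, ← Set.indicator_indicator]
  by_cases h : t ∈ B <;> simp [h, h2]

theorem inner_hermiteProj (hB : MeasurableSet B) (v w : EllTwo) : ⟪v, hermiteProj B w⟫_ℂ =
    ∫ t in B, starRingEnd ℂ (gaussianEquiv v t) * gaussianEquiv w t ∂gaussianMeasure := by
  rw [inner_eq_integral, ← integral_indicator hB]
  refine integral_congr_ae ?_
  filter_upwards [gaussianEquiv_hermiteProj hB w] with t h
  rw [h]
  by_cases h : t ∈ B <;> simp [h]

theorem inner_hermiteProj_left (hB : MeasurableSet B) (v w : EllTwo) :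
    ⟪hermiteProj B v, w⟫_ℂ = ⟪v, hermiteProj B w⟫_ℂ := by
  rw [inner_hermiteProj hB, ← inner_conj_symm, inner_hermiteProj hB, ← integral_conj]
  simp [mul_comm]

theorem norm_sq_hermiteProj (hB : MeasurableSet B) (v : EllTwo) :
    ‖hermiteProj B v‖ ^ 2 = ∫ t in B, ‖gaussianEquiv v t‖ ^ 2 ∂gaussianMeasure := by
  rw [norm_sq_eq_integral, ← integral_indicator hB]
  refine integral_congr_ae ?_
  filter_upwards [gaussianEquiv_hermiteProj hB v] with t h
  rw [h]
  by_cases h : t ∈ B <;> simp [h]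

theorem inner_hermiteProj_hermiteProj (hB : MeasurableSet B) (hC : MeasurableSet C) (v : EllTwo) :
    ⟪hermiteProj B v, hermiteProj C v⟫_ℂ = ((‖hermiteProj (B ∩ C) v‖ ^ 2 : ℝ) : ℂ) := by
  rw [inner_hermiteProj_left hB, hermiteProj_hermiteProj hB hC, inner_hermiteProj (hB.inter hC),
    norm_sq_hermiteProj (hB.inter hC), ← integral_complex_ofReal]
  simp [Complex.conj_mul']

theorem hermiteProj_empty : hermiteProj ∅ = 0 := by
  refine ContinuousLinearMap.ext fun v => ext_gaussianEquiv ?_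
  refine (gaussianEquiv_hermiteProj .empty v).trans ?_
  rw [Set.indicator_empty, zero_apply, map_zero]
  exact (Lp.coeFn_zero ℂ 2 gaussianMeasure).symm

theorem hermiteProj_univ : hermiteProj Set.univ = 1 := by
  refine ContinuousLinearMap.ext fun v => ext_gaussianEquiv ?_
  refine (gaussianEquiv_hermiteProj .univ v).trans ?_
  rw [Set.indicator_univ]
  rfl

/-- The projection-valued measure of multiplication by the variable, transported to `ℓ²`. -/
noncomputable def hermitePVM : ProjectionValuedMeasure EllTwo where
  proj := hermiteProj
  isStarProjection B hB :=
    { isIdempotentElem := ContinuousLinearMap.ext fun v => by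
        rw [mul_apply_eq_comp, hermiteProj_hermiteProj hB hB, Set.inter_self]
      isSelfAdjoint := ContinuousLinearMap.isSelfAdjoint_iff_isSymmetric.2
        (inner_hermiteProj_left hB) }
  proj_empty := hermiteProj_empty
  proj_univ := hermiteProj_univ
  proj_inter B C hB hC := ContinuousLinearMap.ext fun v =>
    (hermiteProj_hermiteProj hB hC v).symm
  hasSum_iUnion f hf hd v := by
    refine hasSum_of_orthogonal (fun i j hij => ?_) (fun i => ?_) ?_
    · beta_reduce
      rw [inner_hermiteProj_hermiteProj (hf i) (hf j), (hd hij).inter_eq, hermiteProj_empty]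
      simp
    · rw [inner_hermiteProj_hermiteProj (.iUnion hf) (hf i),
        Set.inter_eq_right.2 (Set.subset_iUnion f i)]
    · simp only [norm_sq_hermiteProj (hf _), norm_sq_hermiteProj (.iUnion hf)]
      exact hasSum_integral_iUnion hf hd (integrable_norm_sq v).integrableOn

theorem hermitePVM_proj : hermitePVM.proj B = hermiteProj B := rfl

theorem scalarMeasure_hermitePVM (v : EllTwo) : hermitePVM.scalarMeasure v =
    gaussianMeasure.withDensity fun t => ENNReal.ofReal (‖gaussianEquiv v t‖ ^ 2) := by
  ext B hB
  rw [hermitePVM.scalarMeasure_apply v hB, withDensity_apply _ hB, hermitePVM_proj,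
    norm_sq_hermiteProj hB,
    ofReal_integral_eq_lintegral_ofReal (integrable_norm_sq v).integrableOn
      (.of_forall fun t => by positivity)]

theorem hermitePVM_isSpectralMeasureOf :
    hermitePVM.IsSpectralMeasureOf hermiteOperator.closure := by
  have hm (v : EllTwo) : Measurable fun t => ENNReal.ofReal (‖gaussianEquiv v t‖ ^ 2) :=
    ((Lp.stronglyMeasurable (gaussianEquiv v)).measurable.norm.pow_const 2).ennreal_ofReal
  have hr (v : EllTwo) (t : ℝ) : (ENNReal.ofReal (‖gaussianEquiv v t‖ ^ 2)).toReal =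
      ‖gaussianEquiv v t‖ ^ 2 := ENNReal.toReal_ofReal (by positivity)
  refine ⟨fun v => ?_, fun v => ?_⟩
  · have hms : AEStronglyMeasurable (fun t : ℝ => t * gaussianEquiv v t) gaussianMeasure :=
      (Continuous.aestronglyMeasurable (by fun_prop)).mul (Lp.aestronglyMeasurable _)
    rw [mem_hermiteOperator_closure_domain_iff, memLp_two_iff_integrable_sq_norm hms,
      scalarMeasure_hermitePVM,
      integrable_withDensity_iff_integrable_smul' (hm v) (.of_forall fun _ => ENNReal.ofReal_lt_top)]
    simp only [hr, smul_eq_mul, norm_mul, mul_pow, Complex.norm_real, Real.norm_eq_abs, sq_abs,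
      mul_comm]
  · rw [scalarMeasure_hermitePVM, integral_withDensity_eq_integral_toReal_smul (hm v)
      (.of_forall fun _ => ENNReal.ofReal_lt_top), inner_eq_integral, ← integral_complex_ofReal]
    refine integral_congr_ae ?_
    filter_upwards [gaussianEquiv_hermiteOperator_closure v] with t ht
    rw [ht, hr, smul_eq_mul, mul_left_comm, Complex.conj_mul']
    push_cast
    ring

end HermitePVM

/-! ### Uniqueness of the spectral measure -/

section Conclusion

open Polynomial ProbabilityTheory

variable {P : ProjectionValuedMeasure EllTwo} {B C : Set ℝ}

/-- A projection commuting with the operator acts on polynomials as multiplication by the image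
of `1`. -/
theorem gaussianEquiv_proj_deltaVec (h : P.IsSpectralMeasureOf hermiteOperator.closure)
    (hB : MeasurableSet B) (n : ℕ) : gaussianEquiv (P.proj B (deltaVec n)) =ᵐ[gaussianMeasure]
      fun t : ℝ => (((hermitePoly n).eval t : ℝ) : ℂ) *
        gaussianEquiv (P.proj B (deltaVec 0)) t := by
  induction n using Nat.strong_induction_on with
  | _ n ih =>
  rcases n with _ | n
  · simp [hermitePoly_zero]
  · have hmem : deltaVec n ∈ hermiteOperator.closure.domain :=
      hermiteOperator.le_closure.1 (deltaVec_mem n)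
    have happ : hermiteOperator.closure ⟨deltaVec n, hmem⟩ =
        (√((n : ℝ) + 1) : ℂ) • deltaVec (n + 1) + (√(n : ℝ) : ℂ) • deltaVec (n - 1) := by
      rw [← hermiteOperator_deltaVec n (deltaVec_mem n)]
      exact (hermiteOperator.le_closure.2 rfl).symm
    have hcomm := h.apply_proj dense_hermiteOperator_closure_domain hB ⟨deltaVec n, hmem⟩
    rw [happ, map_add, map_smul, map_smul] at hcomm
    have hmul := gaussianEquiv_hermiteOperator_closure
      ⟨P.proj B (deltaVec n), h.proj_mem_domain hB hmem⟩
    rw [hcomm, map_add, map_smul, map_smul] at hmul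
    filter_upwards [hmul, ih n (by omega), ih (n - 1) (by omega),
      Lp.coeFn_add ((√((n : ℝ) + 1) : ℂ) • gaussianEquiv (P.proj B (deltaVec (n + 1))))
        ((√(n : ℝ) : ℂ) • gaussianEquiv (P.proj B (deltaVec (n - 1)))),
      Lp.coeFn_smul (√((n : ℝ) + 1) : ℂ) (gaussianEquiv (P.proj B (deltaVec (n + 1)))),
      Lp.coeFn_smul (√(n : ℝ) : ℂ) (gaussianEquiv (P.proj B (deltaVec (n - 1))))]
      with t h1 h2 h3 h4 h5 h6
    rw [h4, Pi.add_apply, h5, h6, Pi.smul_apply, Pi.smul_apply, h2, h3, smul_eq_mul,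
      smul_eq_mul] at h1
    have h7 := congrArg (fun p : ℝ[X] => ((p.eval t : ℝ) : ℂ)) (X_mul_hermitePoly n)
    simp only [eval_mul, eval_add, eval_X, eval_C] at h7
    push_cast at h7
    have h8 : ((√((n : ℝ) + 1) : ℝ) : ℂ) ≠ 0 := by
      rw [Complex.ofReal_ne_zero]
      positivity
    refine mul_left_cancel₀ h8 ?_
    linear_combination h1 + gaussianEquiv (P.proj B (deltaVec 0)) t * h7

/-- The multiplier by which a spectral projection acts is real, as the projection is
self-adjoint. -/
theorem conj_gaussianEquiv_proj_deltaVec_zero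
    (h : P.IsSpectralMeasureOf hermiteOperator.closure) (hB : MeasurableSet B) :
    ∀ᵐ t ∂gaussianMeasure, starRingEnd ℂ (gaussianEquiv (P.proj B (deltaVec 0)) t) =
      gaussianEquiv (P.proj B (deltaVec 0)) t := by
  set f := gaussianEquiv (P.proj B (deltaVec 0))
  have hi := integrable_eval_mul_exp_mul f
  have hi' (p : ℝ[X]) (c : ℝ) : Integrable
      (fun t => ((p.eval t * Real.exp (c * |t|) : ℝ) : ℂ) * starRingEnd ℂ (f t)) gaussianMeasure := by
    have h1 := (Complex.conjLIE.toContinuousLinearEquiv : ℂ →L[ℝ] ℂ).integrable_comp (hi p c)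
    refine h1.congr (.of_forall fun t => ?_)
    change starRingEnd ℂ (_ * _) = _
    rw [map_mul, Complex.conj_ofReal]
  have hz := ae_eq_zero_of_integral_hermitePoly (k := fun t => starRingEnd ℂ (f t) - f t)
    (fun p c => by
      simp only [mul_sub]
      exact (hi' p c).sub (hi p c))
    (fun n => by
      have h1 : ⟪P.proj B (deltaVec 0), deltaVec n⟫_ℂ =
          ∫ t, (((hermitePoly n).eval t : ℝ) : ℂ) * starRingEnd ℂ (f t) ∂gaussianMeasure := by
        rw [inner_eq_integral]
        refine integral_congr_ae ?_
        filter_upwards [coeFn_gaussianEquiv_deltaVec n] with t ht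
        rw [ht, mul_comm]
      have h2 : ⟪deltaVec 0, P.proj B (deltaVec n)⟫_ℂ =
          ∫ t, (((hermitePoly n).eval t : ℝ) : ℂ) * f t ∂gaussianMeasure := by
        rw [inner_deltaVec_eq_integral]
        refine integral_congr_ae ?_
        filter_upwards [gaussianEquiv_proj_deltaVec h hB n] with t ht
        rw [ht, hermitePoly_zero, eval_one, Complex.ofReal_one, one_mul]
      simp only [mul_sub]
      rw [integral_sub, ← h1, ← h2, P.inner_proj_left hB, sub_self]
      · simpa using hi' (hermitePoly n) 0
      · simpa using hi (hermitePoly n) 0)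
  filter_upwards [hz] with t ht
  exact sub_eq_zero.1 ht

theorem commute_proj_hermiteProj (h : P.IsSpectralMeasureOf hermiteOperator.closure)
    (hB : MeasurableSet B) (hC : MeasurableSet C) : Commute (P.proj B) (hermiteProj C) := by
  have key (n : ℕ) : P.proj B (hermiteProj C (deltaVec n)) =
      hermiteProj C (P.proj B (deltaVec n)) := by
    refine ext_inner_deltaVec fun m => ?_
    rw [← P.inner_proj_left hB, inner_hermiteProj hC, inner_hermiteProj hC]
    refine integral_congr_ae (ae_restrict_of_ae ?_)
    filter_upwards [gaussianEquiv_proj_deltaVec h hB n, gaussianEquiv_proj_deltaVec h hB m,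
      coeFn_gaussianEquiv_deltaVec n, coeFn_gaussianEquiv_deltaVec m,
      conj_gaussianEquiv_proj_deltaVec_zero h hB] with t h1 h2 h3 h4 h5
    rw [h1, h2, h3, h4, map_mul, h5]
    ring
  refine ContinuousLinearMap.ext_on dense_hermiteOperator_domain ?_
  rintro _ ⟨n, rfl⟩
  exact key n

theorem proj_eq_hermiteProj (h : P.IsSpectralMeasureOf hermiteOperator.closure)
    (hB : MeasurableSet B) : P.proj B = hermiteProj B :=
  h.unique_of_commute hermitePVM_isSpectralMeasureOf dense_hermiteOperator_closure_domain
    (fun _ _ hB hC => commute_proj_hermiteProj h hB hC) hB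

/-- The standard basis vector at `0` is cyclic: it corresponds to the constant function `1`, and
functions orthogonal to all indicator functions vanish. -/
theorem dense_span_hermiteProj_deltaVec_zero :
    (Submodule.span ℂ {w : EllTwo | ∃ B : Set ℝ, MeasurableSet B ∧
      w = hermiteProj B (deltaVec 0)}).topologicalClosure = ⊤ := by
  refine Submodule.topologicalClosure_eq_top_iff.2 ((Submodule.eq_bot_iff _).2 fun v hv => ?_)
  have h0 : gaussianEquiv v =ᵐ[gaussianMeasure] 0 := by
    refine ((Lp.memLp (gaussianEquiv v)).integrable one_le_two)
      |>.ae_eq_zero_of_forall_setIntegral_eq_zero fun B hB _ => ?_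
    have hmem : hermiteProj B (deltaVec 0) ∈ {w : EllTwo | ∃ B : Set ℝ, MeasurableSet B ∧
      w = hermiteProj B (deltaVec 0)} := ⟨B, hB, rfl⟩
    have h1 : ⟪hermiteProj B (deltaVec 0), v⟫_ℂ = 0 :=
      Submodule.inner_right_of_mem_orthogonal (Submodule.subset_span hmem) hv
    rw [inner_hermiteProj_left hB, inner_hermiteProj hB] at h1
    rw [← h1]
    refine integral_congr_ae (ae_restrict_of_ae ?_)
    filter_upwards [coeFn_gaussianEquiv_deltaVec 0] with t ht
    simp [ht, hermitePoly_zero]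
  refine gaussianEquiv.injective ?_
  rw [map_zero]
  exact (Lp.eq_zero_iff_ae_eq_zero).2 h0

theorem volume_eq_zero_iff_gaussianMeasure : volume B = 0 ↔ gaussianMeasure B = 0 :=
  ⟨fun h => gaussianReal_absolutelyContinuous 0 one_ne_zero h,
    fun h => gaussianReal_absolutelyContinuous' 0 one_ne_zero h⟩

theorem hermiteProj_eq_zero_iff (hB : MeasurableSet B) : hermiteProj B = 0 ↔ volume B = 0 := by
  rw [volume_eq_zero_iff_gaussianMeasure]
  refine ⟨fun h => ?_, fun h => ContinuousLinearMap.ext fun v => ?_⟩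
  · -- `‖P_B δ₀‖²` is the Gaussian measure of `B`.
    have h1 := norm_sq_hermiteProj hB (deltaVec 0)
    have h2 : ∫ t in B, ‖gaussianEquiv (deltaVec 0) t‖ ^ 2 ∂gaussianMeasure =
        ∫ _ in B, (1 : ℝ) ∂gaussianMeasure := by
      refine integral_congr_ae (ae_restrict_of_ae ?_)
      filter_upwards [coeFn_gaussianEquiv_deltaVec 0] with t ht
      simp [ht, hermitePoly_zero]
    rw [h, h2] at h1
    simpa [measureReal_def, ENNReal.toReal_eq_zero_iff] using h1.symm
  · have h1 := norm_sq_hermiteProj hB v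
    rw [Measure.restrict_eq_zero.2 h, integral_zero_measure] at h1
    simpa using h1

theorem inner_hermiteProj_deltaVec (hB : MeasurableSet B) (x y : ℕ) :
    ⟪deltaVec x, hermiteProj B (deltaVec y)⟫_ℂ = (hermiteKernel B x y : ℂ) := by
  have h1 : ⟪deltaVec x, hermiteProj B (deltaVec y)⟫_ℂ =
      ∫ t in B, (((hermitePoly x).eval t * (hermitePoly y).eval t : ℝ) : ℂ) ∂gaussianMeasure := by
    rw [inner_hermiteProj hB]
    refine integral_congr_ae (ae_restrict_of_ae ?_)
    filter_upwards [coeFn_gaussianEquiv_deltaVec x, coeFn_gaussianEquiv_deltaVec y] with t h2 h3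
    rw [h2, h3, Complex.conj_ofReal, Complex.ofReal_mul]
  rw [h1, integral_complex_ofReal, ← integral_indicator hB,
    integral_gaussianReal_eq_integral_smul one_ne_zero, hermiteKernel, ← integral_const_mul,
    ← integral_indicator hB]
  congr 2
  funext t
  by_cases ht : t ∈ B
  · have hc : (2 * Real.pi * (x.factorial : ℝ) * (y.factorial : ℝ) * 2 ^ (x + y)) ^ (-(1 / 2) : ℝ) =
        (√(2 * Real.pi))⁻¹ * (√(2 ^ x * x.factorial))⁻¹ * (√(2 ^ y * y.factorial))⁻¹ := by
      rw [Real.rpow_neg (by positivity), ← Real.sqrt_eq_rpow, ← mul_inv, ← mul_inv,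
        ← Real.sqrt_mul (by positivity), ← Real.sqrt_mul (by positivity)]
      congr 2
      ring
    rw [hc]
    simp only [ht, Set.indicator_of_mem, smul_eq_mul, gaussianPDFReal, hermitePoly, eval_mul,
      eval_C, eval_comp, eval_X, NNReal.coe_one, mul_one, sub_zero, div_eq_inv_mul t]
    ring
  · simp [ht]

end Conclusion

theorem lemma3p1 :
    IsEssentiallySelfAdjoint hermiteOperator ∧
    (∃ P : ProjectionValuedMeasure EllTwo, P.IsSpectralMeasureOf hermiteOperator.closure) ∧
    ∀ P : ProjectionValuedMeasure EllTwo, P.IsSpectralMeasureOf hermiteOperator.closure →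
      P.HasSimpleSpectrum ∧
      P.IsPurelyAbsolutelyContinuous ∧
      P.HasLebesgueSpectralType ∧
      ∀ B : Set ℝ, MeasurableSet B → ∀ x y : ℕ,
        ⟪deltaVec x, P.proj B (deltaVec y)⟫_ℂ = (hermiteKernel B x y : ℂ) := by
  refine ⟨isEssentiallySelfAdjoint_of_adjoint_symmetric dense_hermiteOperator_domain
    hermiteOperator_symmetric hermiteOperator_adjoint_symmetric,
    ⟨hermitePVM, hermitePVM_isSpectralMeasureOf⟩, fun P h => ⟨⟨deltaVec 0, ?_⟩, fun v => ?_,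
      fun B hB => ?_, fun B hB x y => ?_⟩⟩
  · rw [← dense_span_hermiteProj_deltaVec_zero]
    congr 2
    ext w
    exact exists_congr fun B => and_congr_right fun hB => by rw [proj_eq_hermiteProj h hB]
  · refine Measure.AbsolutelyContinuous.mk fun B hB h0 => ?_
    rw [P.scalarMeasure_apply v hB, proj_eq_hermiteProj h hB, (hermiteProj_eq_zero_iff hB).2 h0]
    simp
  · rw [proj_eq_hermiteProj h hB, hermiteProj_eq_zero_iff hB]
  · rw [proj_eq_hermiteProj h hB, inner_hermiteProj_deltaVec hB]
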